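/- Let $1\le p<\infty$ and let $(e_k)_{k\ge 0}$ be the canonical basis of the complex space $\ell^p(\mathbb N)$. **Operators of C-type.** Let $v=(v_n)_{n\ge1}$ be non-zero complex numbers with $\sum_{n\ge1}|v_n|<\infty$; let $b=(b_n)_{n\ge0}$ be a strictly increasing sequence of integers with $b_0=0$; let $\varphi:\mathbb N\to\mathbb N$ satisfy $\varphi(0)=0$, $\varphi(n)<n$ for $n\ge1$ and $\varphi^{-1}(l)$ infinite for every $l\ge 0$; assume that $b_{n+1}-b_n$ is a multiple of $2(b_{\varphi(n)+1}-b_{\varphi(n)})$ for every $n\ge1$; and let $w=(w_k)_{k\ge1}$ be complex numbers with $0<\inf_k|w_k|\le\sup_k|w_k|<\infty$ and $\inf_{n\ge0}|W_n|>0$, where $W_n=\prod_{b_n<j<b_{n+1}}w_j$. The operator of C-type $T=T_{v,w,\varphi,b}$ is the unique bounded operator on $\ell^p(\mathbb N)$ with $$Te_k=\begin{cases} w_{k+1}e_{k+1} & \text{if } k\in[b_n,b_{n+1}-1),\ n\ge0,\\ v_ne_{b_{\varphi(n)}}-W_n^{-1}e_{b_n} & \text{if } k=b_{n+1}-1,\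 n\ge1,\\ -W_0^{-1}e_0 & \text{if } k=b_1-1.\end{cases}$$ **The chosen operator.** Let $(\tau^{(k)})_{k\ge1}$, $(\delta^{(k)})_{k\ge1}$, $(\eta^{(k)})_{k\ge1}$ be strictly increasing sequences of positive integers and let $(\Delta^{(k)})_{k\ge1}$ be integers with $4\delta^{(k)}+2\eta^{(k)}<\Delta^{(k)}$ for every $k\ge1$. Assume that $T$ is of C$^+$-type with these parameters, that is, for every $k\ge1$ and every $n\in[2^{k-1},2^k)$: $\varphi(n)=n-2^{k-1}$, $b_{n+1}-b_n=\Delta^{(k)}$, $v_n=2^{-\tau^{(k)}}$, and $w_{b_n+i}=w^{(k)}_i$ for $1\le i<\Delta^{(k)}$, where $$w_i^{(k)}=\begin{cases}\frac12&\text{if }1\le i\le\delta^{(k)},\\ 2&\text{if }\delta^{(k)}<i\le2\delta^{(k)},\\ 1&\text{if }2\delta^{(k)}<i<\Delta^{(k)}-2\delta^{(k)}-2\eta^{(k)},\\ \frac12&\text{if }\Delta^{(k)}-2\delta^{(k)}-2\eta^{(k)}\le i<\Delta^{(k)}-\delta^{(k)}-2\eta^{(k)},\\ 1&\text{if }\Delta^{(k)}-\delta^{(k)}-2\eta^{(k)}\le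 i<\Delta^{(k)}-\delta^{(k)}-\eta^{(k)},\\ 2&\text{if }\Delta^{(k)}-\delta^{(k)}-\eta^{(k)}\le i<\Delta^{(k)}-\eta^{(k)},\\ 1&\text{if }\Delta^{(k)}-\eta^{(k)}\le i<\Delta^{(k)}.\end{cases}$$ **Proposition.** If $\lim_{k\to\infty}(\delta^{(k)}-\tau^{(k)})=\infty$ and $\liminf_{k\to\infty}\delta^{(k)}/\eta^{(k)}<\infty$, then $T$ is invertible and $T^{-1}$ is $\mathcal U$-frequently hypercyclic: there is $x\in\ell^p(\mathbb N)$ such that for every non-empty open $U\subseteq\ell^p(\mathbb N)$ the set $\mathcal N=\{n\ge0: T^{-n}x\in U\}$ has positive upper density, $\limsup_{N\to\infty}\frac{\#(\mathcal N\cap[0,N])}{N+1}>0$. -/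

import Mathlib

open Filter Topology
open scoped ENNReal

noncomputable section

/-- The complex sequence space `ℓ^p(ℕ)`, indices starting at `0`. -/
abbrev EllP (p : ℝ≥0∞) : Type := lp (fun _ : ℕ => ℂ) p

/-- The canonical basis vector `e_k` of `ℓ^p(ℕ)`. -/
abbrev basisVec (p : ℝ≥0∞) (k : ℕ) : EllP p := lp.single p k (1 : ℂ)

/-- The upper density `limsup_N #(A ∩ [0, N]) / (N + 1)` of a set of natural numbers. -/
def upperDensity (A : Set ℕ) : ℝ :=
  limsup (fun N : ℕ => ((A ∩ Set.Iic N).ncard : ℝ) / ((N : ℝ) + 1)) atTop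

/-- `T` is `𝒰`-frequently hypercyclic: some orbit visits every non-empty open set along a set of
times of positive upper density. -/
def IsUFrequentlyHypercyclic {X : Type*} [NormedAddCommGroup X] [NormedSpace ℂ X]
    (T : X →L[ℂ] X) : Prop :=
  ∃ x : X, ∀ U : Set X, IsOpen U → U.Nonempty → 0 < upperDensity {n : ℕ | (T ^ n) x ∈ U}

/-- The parameters `(v, w, φ, b)` of an operator of C-type. The sequences `v` and `w` are indexed
by `n ≥ 1`; their values at `0` play no role. -/
structure CTypeData where
  v : ℕ → ℂ
  w : ℕ → ℂ
  φ : ℕ → ℕ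
  b : ℕ → ℕ
  v_ne_zero : ∀ n, 1 ≤ n → v n ≠ 0
  summable_v : Summable fun n => ‖v (n + 1)‖
  w_bddBelow : ∃ c : ℝ, 0 < c ∧ ∀ k, 1 ≤ k → c ≤ ‖w k‖
  w_bddAbove : ∃ M : ℝ, ∀ k, 1 ≤ k → ‖w k‖ ≤ M
  W_bddBelow : ∃ c : ℝ, 0 < c ∧ ∀ n, c ≤ ‖∏ j ∈ Finset.Ioo (b n) (b (n + 1)), w j‖
  φ_zero : φ 0 = 0
  φ_lt : ∀ n, 1 ≤ n → φ n < n
  φ_fiber_infinite : ∀ l, {n | φ n = l}.Infinite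
  b_zero : b 0 = 0
  b_strictMono : StrictMono b
  b_dvd : ∀ n, 1 ≤ n → 2 * (b (φ n + 1) - b (φ n)) ∣ b (n + 1) - b n

namespace CTypeData

/-- `W_n`, the product of the weights `w_j` over `b_n < j < b_{n+1}`. -/
def W (D : CTypeData) (n : ℕ) : ℂ := ∏ j ∈ Finset.Ioo (D.b n) (D.b (n + 1)), D.w j

/-- `T` acts on the canonical basis as the operator of C-type with parameters `D`. -/
structure ActsOnBasis (D : CTypeData) {p : ℝ≥0∞} [Fact (1 ≤ p)]
    (T : EllP p →L[ℂ] EllP p) : Prop where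
  shift : ∀ n k, D.b n ≤ k → k + 1 < D.b (n + 1) →
    T (basisVec p k) = D.w (k + 1) • basisVec p (k + 1)
  last : ∀ n, 1 ≤ n → T (basisVec p (D.b (n + 1) - 1)) =
    D.v n • basisVec p (D.b (D.φ n)) - (D.W n)⁻¹ • basisVec p (D.b n)
  first : T (basisVec p (D.b 1 - 1)) = -((D.W 0)⁻¹ • basisVec p 0)

theorem exists_block (D : CTypeData) (k : ℕ) : ∃ n, D.b n ≤ k ∧ k < D.b (n + 1) := by
  induction k with
  | zero => exact ⟨0, D.b_zero.le, (Nat.zero_le _).trans_lt (D.b_strictMono (Nat.lt_succ_self 0))⟩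
  | succ k ih =>
    obtain ⟨n, h1, h2⟩ := ih
    by_cases h : k + 1 < D.b (n + 1)
    · exact ⟨n, by omega, h⟩
    · exact ⟨n + 1, by omega, by
        have := D.b_strictMono (Nat.lt_succ_self (n + 1)); simp only [Nat.succ_eq_add_one] at this
        omega⟩

theorem ActsOnBasis.unique (D : CTypeData) {p : ℝ≥0∞} [Fact (1 ≤ p)] (hp : p ≠ ∞)
    {T S : EllP p →L[ℂ] EllP p} (hT : D.ActsOnBasis T) (hS : D.ActsOnBasis S) : T = S := by
  have key : ∀ k, T (basisVec p k) = S (basisVec p k) := by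
    intro k
    obtain ⟨n, h1, h2⟩ := D.exists_block k
    by_cases h : k + 1 < D.b (n + 1)
    · rw [hT.shift n k h1 h, hS.shift n k h1 h]
    · obtain rfl : k = D.b (n + 1) - 1 := by omega
      rcases Nat.eq_zero_or_pos n with rfl | hn
      · exact hT.first.trans hS.first.symm
      · rw [hT.last n hn, hS.last n hn]
  refine lp.ext_continuousLinearMap hp fun i => ?_
  refine ContinuousLinearMap.ext_ring ?_
  exact key i

/-- Bounded weights composed with an injective relabelling give a bounded operator. -/
theorem exists_weighted_relabelling {p : ℝ≥0∞} [Fact (1 ≤ p)] (hp : p ≠ ∞) (σ : ℕ → ℕ)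
    (hσ : Function.Injective σ) (a : ℕ → ℂ) (M : ℝ) (ha : ∀ j, ‖a j‖ ≤ M) :
    ∃ A : EllP p →L[ℂ] EllP p, ∀ j, A (basisVec p (σ j)) = a j • basisVec p j := by
  have hp0 : 0 < p.toReal :=
    ENNReal.toReal_pos (zero_lt_one.trans_le (Fact.out : 1 ≤ p)).ne' hp
  have hM : 0 ≤ M := (norm_nonneg _).trans (ha 0)
  have hle : ∀ (x : EllP p) (s : Finset ℕ),
      ∑ j ∈ s, ‖a j * x (σ j)‖ ^ p.toReal ≤ (M * ‖x‖) ^ p.toReal := by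
    intro x s
    calc ∑ j ∈ s, ‖a j * x (σ j)‖ ^ p.toReal
        ≤ ∑ j ∈ s, M ^ p.toReal * ‖x (σ j)‖ ^ p.toReal := by
          refine Finset.sum_le_sum fun j _ => ?_
          rw [norm_mul, Real.mul_rpow (norm_nonneg _) (norm_nonneg _)]
          gcongr
          exact ha j
      _ = M ^ p.toReal * ∑ i ∈ s.map ⟨σ, hσ⟩, ‖x i‖ ^ p.toReal := by
          rw [Finset.sum_map, Finset.mul_sum]; rfl
      _ ≤ M ^ p.toReal * ‖x‖ ^ p.toReal := by
          gcongr
          exact lp.sum_rpow_le_norm_rpow hp0 x _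
      _ = (M * ‖x‖) ^ p.toReal := (Real.mul_rpow hM (norm_nonneg _)).symm
  let L : EllP p →ₗ[ℂ] EllP p :=
    { toFun := fun x => ⟨fun j => a j * x (σ j), memℓp_gen' (hle x)⟩
      map_add' := fun x y => by
        ext j
        exact mul_add _ _ _
      map_smul' := fun c x => by
        ext j
        exact mul_left_comm _ _ _ }
  refine ⟨L.mkContinuous M fun x =>
    lp.norm_le_of_forall_sum_le hp0 (mul_nonneg hM (norm_nonneg _)) (hle x), fun j => ?_⟩
  ext i
  change a i * (lp.single p (σ j) (1 : ℂ) : EllP p) (σ i) = a j * (lp.single p j (1 : ℂ) : EllP p) i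
  by_cases h : i = j
  · subst h; simp
  · rw [lp.single_apply_ne p _ _ h, lp.single_apply_ne p _ _ (fun e => h (hσ e))]
    simp

theorem exists_actsOnBasis (D : CTypeData) (p : ℝ≥0∞) [Fact (1 ≤ p)] (hp : p ≠ ∞) :
    ∃ T : EllP p →L[ℂ] EllP p, D.ActsOnBasis T := by
  classical
  have hb1 : ∀ n, D.b n < D.b (n + 1) := fun n => D.b_strictMono (Nat.lt_succ_self n)
  have hbinj := D.b_strictMono.injective
  -- the cyclic relabelling of the blocks and its weights
  let σ : ℕ → ℕ := fun j => if h : ∃ n, D.b n = j then D.b (h.choose + 1) - 1 else j - 1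
  let a : ℕ → ℂ := fun j => if h : ∃ n, D.b n = j then -(D.W h.choose)⁻¹ else D.w j
  have hσb : ∀ n, σ (D.b n) = D.b (n + 1) - 1 := by
    intro n
    have h : ∃ m, D.b m = D.b n := ⟨n, rfl⟩
    have e : h.choose = n := hbinj h.choose_spec
    simp only [σ, dif_pos h, e]
  have hab : ∀ n, a (D.b n) = -(D.W n)⁻¹ := by
    intro n
    have h : ∃ m, D.b m = D.b n := ⟨n, rfl⟩
    have e : h.choose = n := hbinj h.choose_spec
    simp only [a, dif_pos h, e]
  have hpos : ∀ j, (¬ ∃ n, D.b n = j) → 1 ≤ j := by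
    intro j hj
    rcases Nat.eq_zero_or_pos j with rfl | h
    · exact absurd ⟨0, D.b_zero⟩ hj
    · exact h
  have hσ : Function.Injective σ := by
    intro i j hij
    by_cases hi : ∃ n, D.b n = i <;> by_cases hj : ∃ n, D.b n = j
    · obtain ⟨n, rfl⟩ := hi
      obtain ⟨m, rfl⟩ := hj
      rw [hσb, hσb] at hij
      have : D.b (n + 1) = D.b (m + 1) := by have := hb1 n; have := hb1 m; omega
      have := hbinj this
      rw [Nat.add_right_cancel this]
    · obtain ⟨n, rfl⟩ := hi
      rw [hσb] at hij
      simp only [σ, dif_neg hj] at hij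
      exact absurd ⟨n + 1, by have := hb1 n; have := hpos j hj; omega⟩ hj
    · obtain ⟨n, rfl⟩ := hj
      rw [hσb] at hij
      simp only [σ, dif_neg hi] at hij
      exact absurd ⟨n + 1, by have := hb1 n; have := hpos i hi; omega⟩ hi
    · simp only [σ, dif_neg hi, dif_neg hj] at hij
      have := hpos i hi
      have := hpos j hj
      omega
  obtain ⟨M, hM⟩ := D.w_bddAbove
  obtain ⟨c, hc, hW⟩ := D.W_bddBelow
  have ha : ∀ j, ‖a j‖ ≤ max M c⁻¹ := by
    intro j
    by_cases hj : ∃ n, D.b n = j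
    · obtain ⟨n, rfl⟩ := hj
      rw [hab, norm_neg, norm_inv]
      exact (inv_anti₀ hc (hW n)).trans (le_max_right _ _)
    · simp only [a, dif_neg hj]
      exact (hM j (hpos j hj)).trans (le_max_left _ _)
  obtain ⟨A, hA⟩ := exists_weighted_relabelling hp σ hσ a _ ha
  -- the part carried by `v`
  let F : ℕ → (EllP p →L[ℂ] EllP p) := fun n =>
    D.v (n + 1) • (lp.evalCLM ℂ (fun _ : ℕ => ℂ) p (D.b (n + 2) - 1)).smulRight
      (basisVec p (D.b (D.φ (n + 1))))
  have hFapp : ∀ n x, F n x =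
      (D.v (n + 1) * x (D.b (n + 2) - 1)) • basisVec p (D.b (D.φ (n + 1))) := by
    intro n x
    simp only [F, smul_apply, ContinuousLinearMap.smulRight_apply, smul_smul]
    rfl
  have hp1 : 0 < p := zero_lt_one.trans_le (Fact.out : 1 ≤ p)
  have hF : Summable F := by
    refine Summable.of_norm_bounded D.summable_v fun n => ?_
    refine ContinuousLinearMap.opNorm_le_bound _ (norm_nonneg _) fun x => ?_
    rw [hFapp, norm_smul, norm_mul, lp.norm_single hp1, norm_one, mul_one]
    gcongr
    exact lp.norm_apply_le_norm hp1.ne' x _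
  have hsum : ∀ x, (∑' n, F n) x = ∑' n, F n x := fun x =>
    (ContinuousLinearMap.apply ℂ (EllP p) x).map_tsum hF
  have hK0 : ∀ k, (∀ n, k ≠ D.b (n + 2) - 1) → (∑' n, F n) (basisVec p k) = 0 := by
    intro k hk
    rw [hsum]
    convert tsum_zero with n
    rw [hFapp, lp.single_apply_ne p _ _ (hk n).symm]
    simp
  have hK1 : ∀ n, (∑' n, F n) (basisVec p (D.b (n + 2) - 1)) =
      D.v (n + 1) • basisVec p (D.b (D.φ (n + 1))) := by
    intro n
    rw [hsum, tsum_eq_single n, hFapp, lp.single_apply_self, mul_one]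
    intro m hm
    rw [hFapp, lp.single_apply_ne, mul_zero, zero_smul]
    intro e
    apply hm
    have h1 : D.b (n + 1) < D.b (n + 2) := hb1 (n + 1)
    have h2 : D.b (m + 1) < D.b (m + 2) := hb1 (m + 1)
    have := hbinj (show D.b (m + 2) = D.b (n + 2) by omega)
    omega
  refine ⟨A + ∑' n, F n, ?_, ?_, ?_⟩
  · intro n k h1 h2
    have hk : ¬ ∃ m, D.b m = k + 1 := by
      rintro ⟨m, hm⟩
      have h3 : n < m := D.b_strictMono.lt_iff_lt.1 (by omega)
      have h4 : m < n + 1 := D.b_strictMono.lt_iff_lt.1 (by omega)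
      omega
    have e := hA (k + 1)
    simp only [σ, a, dif_neg hk, Nat.add_sub_cancel] at e
    rw [add_apply, e, hK0, add_zero]
    intro m hm
    have h3 : D.b (m + 1) < D.b (m + 2) := hb1 (m + 1)
    exact hk ⟨m + 2, by omega⟩
  · intro n hn
    obtain ⟨m, rfl⟩ := Nat.exists_eq_add_of_le' hn
    have e := hA (D.b (m + 1))
    rw [hσb, hab] at e
    rw [add_apply, e, hK1, neg_smul]
    abel
  · have e := hA (D.b 0)
    rw [hσb, hab, D.b_zero] at e
    rw [add_apply, show D.b 1 = D.b (0 + 1) from rfl, e, hK0, add_zero, neg_smul]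
    intro m hm
    have h1 : D.b 0 < D.b 1 := hb1 0
    have h2 : D.b (m + 1) < D.b (m + 2) := hb1 (m + 1)
    have h3 : D.b 1 - 1 = D.b (m + 2) - 1 := hm
    have := hbinj (show D.b (m + 2) = D.b 1 by omega)
    omega

/-- The operator of C-type `T_{v,w,φ,b}` on `ℓ^p(ℕ)`, `1 ≤ p < ∞`: the unique bounded operator
with the prescribed action on the canonical basis. -/
def operator (D : CTypeData) (p : ℝ≥0∞) [Fact (1 ≤ p)] (hp : p ≠ ∞) : EllP p →L[ℂ] EllP p :=
  (D.exists_actsOnBasis p hp).choose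

theorem operator_actsOnBasis (D : CTypeData) (p : ℝ≥0∞) [Fact (1 ≤ p)] (hp : p ≠ ∞) :
    D.ActsOnBasis (D.operator p hp) :=
  (D.exists_actsOnBasis p hp).choose_spec

/-- The parameters are of C⁺-type, with block sizes `Δ k`, values `vv k` of `v`, and weights
`ww k i` for `1 ≤ i < Δ k`, on the `k`-th generation `2^(k-1) ≤ n < 2^k`, `k ≥ 1`. The block
`[b_0, b_1)` belongs to no generation. -/
structure IsCPlusType (D : CTypeData) (Δ : ℕ → ℕ) (vv : ℕ → ℂ) (ww : ℕ → ℕ → ℂ) : Prop where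
  φ_eq : ∀ k, 1 ≤ k → ∀ n ∈ Set.Ico (2 ^ (k - 1)) (2 ^ k), D.φ n = n - 2 ^ (k - 1)
  block_size : ∀ k, 1 ≤ k → ∀ n ∈ Set.Ico (2 ^ (k - 1)) (2 ^ k), D.b (n + 1) - D.b n = Δ k
  v_eq : ∀ k, 1 ≤ k → ∀ n ∈ Set.Ico (2 ^ (k - 1)) (2 ^ k), D.v n = vv k
  w_eq : ∀ k, 1 ≤ k → ∀ n ∈ Set.Ico (2 ^ (k - 1)) (2 ^ k), ∀ i, 1 ≤ i → i < Δ k →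
    D.w (D.b n + i) = ww k i

end CTypeData

/-- The weight at position `1 ≤ i < Δ` in a block of size `Δ`, for `4δ + 2η < Δ`:
`1/2` for `i ≤ δ`; `2` for `δ < i ≤ 2δ`; `1` for `2δ < i < Δ - 2δ - 2η`;
`1/2` for `Δ - 2δ - 2η ≤ i < Δ - δ - 2η`; `1` for `Δ - δ - 2η ≤ i < Δ - δ - η`;
`2` for `Δ - δ - η ≤ i < Δ - η`; `1` for `Δ - η ≤ i < Δ`. -/
def blockWeight (δ η Δ i : ℕ) : ℂ :=
  if i ≤ δ then 1 / 2
  else if i ≤ 2 * δ then 2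
  else if i + 2 * δ + 2 * η < Δ then 1
  else if i + δ + 2 * η < Δ then 1 / 2
  else if i + δ + η < Δ then 1
  else if i + η < Δ then 2
  else 1

end

/-! ### A Baire category criterion for upper frequent hypercyclicity -/

section Criterion

variable {X : Type*} [NormedAddCommGroup X] [NormedSpace ℂ X]

/-! Write `S = T⁻¹`. For fixed `j` put `n = j + 2^(k-1)`, the index of generation `k` with `φ n =
j`. Since `W_n = 1`, crossing its block gives `T^Δ e_{b_n} = 2^(-τ) e_{b_j} - e_{b_n}`. Applying
`2^τ S^m` shows that `2^τ S^m e_{b_n}` follows `S^m e_{b_j}` with error `2^τ T^(Δ-m) e_{b_n}`. The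
weights give this error the norm `2^(τ-δ)` for `η + 1` consecutive `m`. The vector `z = 2^τ T^δ
e_{b_n}` has the same small norm and `S^δ z = 2^τ e_{b_n}`, so vectors tending to `0` shadow
`e_{b_j}` on long windows (`IsCPlusType.basisVec_mem_shadowedVectors`). Each `e_{b_j}` is also
periodic (`ActsOnBasis.pow_two_mul_block_apply`), so periodic shadowed vectors are dense.

Given a periodic target `y` and a periodic starting point `u`, add to `u` a small vector shadowing
`y - S^t u`, where `t` is the delay modulo the period of `u`. In the window the orbit of `u`
cancels, and `y` is approached at every multiple of its period. As `liminf δ/η < ∞`, the window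
fills a fixed proportion of the elapsed time infinitely often. This proportion does not depend on
`u`, so Baire category concludes (`isUFrequentlyHypercyclic_of_shadowedVectors`). -/

theorem isOpen_setOf_le_ncard_visits (S : X →L[ℂ] X) {V : Set X} (hV : IsOpen V) (N q : ℕ) :
    IsOpen {x : X | q ≤ ({m : ℕ | (S ^ m) x ∈ V} ∩ Set.Iic N).ncard} := by
  rw [isOpen_iff_mem_nhds]
  intro x hx
  have hfin : ∀ y : X, ({m : ℕ | (S ^ m) y ∈ V} ∩ Set.Iic N).Finite :=
    fun y => (Set.finite_Iic N).inter_of_right _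
  have hev : ∀ᶠ y in 𝓝 x, ∀ m ∈ {m : ℕ | (S ^ m) x ∈ V} ∩ Set.Iic N, (S ^ m) y ∈ V := by
    rw [(hfin x).eventually_all]
    intro m hm
    exact (S ^ m).continuous.continuousAt.eventually (hV.mem_nhds hm.1)
  filter_upwards [hev] with y hy
  exact le_trans hx (Set.ncard_le_ncard (fun m hm => ⟨hy m hm, hm.2⟩) (hfin y))

theorem le_upperDensity_of_frequently {A : Set ℕ} {c : ℝ}
    (h : ∃ᶠ N : ℕ in atTop, c * ((N : ℝ) + 1) ≤ ((A ∩ Set.Iic N).ncard : ℝ)) :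
    c ≤ upperDensity A := by
  refine le_limsup_of_frequently_le (h.mono fun N hN => ?_) ?_
  · rwa [le_div_iff₀ (by positivity)]
  -- A real `limsup` takes a default value on unbounded sequences; here the ratios are at most `1`.
  · refine isBoundedUnder_of ⟨1, fun N => ?_⟩
    rw [div_le_one (by positivity)]
    have h1 : (A ∩ Set.Iic N).ncard ≤ (Set.Iic N).ncard :=
      Set.ncard_le_ncard Set.inter_subset_right (Set.finite_Iic N)
    have h2 : (Set.Iic N).ncard = N + 1 := by
      rw [← Finset.coe_Iic, Set.ncard_coe_finset, Nat.card_Iic]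
    rw [h2] at h1
    exact_mod_cast h1

/-- If for every target `V` there is a constant `c > 0` such that every non-empty open set contains
a point visiting `V` with frequency at least `c` up to arbitrarily late times, then the operator is
`𝒰`-frequently hypercyclic. -/
theorem isUFrequentlyHypercyclic_of_frequent_visits [CompleteSpace X] [SecondCountableTopology X]
    (S : X →L[ℂ] X)
    (h : ∀ V : Set X, IsOpen V → V.Nonempty → ∃ c : ℝ, 0 < c ∧ ∀ U : Set X, IsOpen U →
      U.Nonempty → ∀ n : ℕ, ∃ x ∈ U, ∃ N, n ≤ N ∧
        c * ((N : ℝ) + 1) ≤ (({m : ℕ | (S ^ m) x ∈ V} ∩ Set.Iic N).ncard : ℝ)) :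
    IsUFrequentlyHypercyclic S := by
  have hB := TopologicalSpace.isBasis_countableBasis X
  have hcount := TopologicalSpace.countable_countableBasis X
  have : Countable (TopologicalSpace.countableBasis X) := hcount
  have hne : ∀ V : TopologicalSpace.countableBasis X, (V : Set X).Nonempty := fun V =>
    TopologicalSpace.nonempty_of_mem_countableBasis V.2
  choose c hc hU using fun V : TopologicalSpace.countableBasis X => h V (hB.isOpen V.2) (hne V)
  let G : TopologicalSpace.countableBasis X × ℕ → Set X := fun i =>
    ⋃ N ∈ Set.Ici i.2, {x | ⌈c i.1 * ((N : ℝ) + 1)⌉₊ ≤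
      ({m : ℕ | (S ^ m) x ∈ (i.1 : Set X)} ∩ Set.Iic N).ncard}
  have hG : Dense (⋂ i, G i) := by
    refine dense_iInter_of_isOpen (fun i => ?_) (fun i => ?_)
    · exact isOpen_biUnion fun N _ => isOpen_setOf_le_ncard_visits S (hB.isOpen i.1.2) N _
    · rw [dense_iff_inter_open]
      intro U hUo hUn
      obtain ⟨x, hxU, N, hN, hx⟩ := hU i.1 U hUo hUn i.2
      exact ⟨x, hxU, Set.mem_biUnion (Set.mem_Ici.2 hN) (Nat.ceil_le.2 hx)⟩
  obtain ⟨x, hx⟩ := hG.nonempty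
  refine ⟨x, fun U hUo hUn => ?_⟩
  obtain ⟨y, hy⟩ := hUn
  obtain ⟨V, hV, -, hVU⟩ := hB.exists_subset_of_mem_open hy hUo
  refine (hc ⟨V, hV⟩).trans_le (le_upperDensity_of_frequently ?_)
  rw [frequently_atTop]
  intro n
  have hxn := Set.mem_iInter.1 hx (⟨V, hV⟩, n)
  simp only [G, Set.mem_iUnion] at hxn
  obtain ⟨N, hN, hle⟩ := hxn
  refine ⟨N, hN, (Nat.ceil_le.1 hle).trans ?_⟩
  have hsub : {m : ℕ | (S ^ m) x ∈ V} ∩ Set.Iic N ⊆ {m : ℕ | (S ^ m) x ∈ U} ∩ Set.Iic N :=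
    fun m hm => ⟨hVU hm.1, hm.2⟩
  exact_mod_cast Set.ncard_le_ncard hsub ((Set.finite_Iic N).inter_of_right _)

/-! ### Periodic and shadowed vectors -/

theorem pow_mul_apply_of_periodic {S : X →L[ℂ] X} {x : X} {P : ℕ} (h : (S ^ P) x = x) (j : ℕ) :
    (S ^ (P * j)) x = x := by
  induction j with
  | zero => simp
  | succ j ih => rw [Nat.mul_succ, pow_add, mul_apply_eq_comp, h, ih]

/-- The subspace of periodic vectors of `S`. -/
def periodicVectors (S : X →L[ℂ] X) : Submodule ℂ X where
  carrier := {x | ∃ P, 0 < P ∧ (S ^ P) x = x}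
  zero_mem' := ⟨1, one_pos, map_zero _⟩
  add_mem' := by
    rintro x y ⟨P, hP, hx⟩ ⟨Q, hQ, hy⟩
    refine ⟨P * Q, Nat.mul_pos hP hQ, ?_⟩
    rw [map_add, pow_mul_apply_of_periodic hx, mul_comm, pow_mul_apply_of_periodic hy]
  smul_mem' := by
    rintro a x ⟨P, hP, hx⟩
    exact ⟨P, hP, by rw [map_smul, hx]⟩

theorem pow_mod_apply_of_periodic {S : X →L[ℂ] X} {x : X} {P : ℕ} (h : (S ^ P) x = x) (j : ℕ) :
    (S ^ (j % P)) x = (S ^ j) x := by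
  conv_rhs => rw [← Nat.mod_add_div j P, pow_add, mul_apply_eq_comp,
    pow_mul_apply_of_periodic h]

/-- The vectors `y` whose orbit is followed, on the windows `[a k, a k + d k]` and with delay `s k`,
by the orbits of vectors `z k` tending to `0`. -/
def shadowedVectors (S : X →L[ℂ] X) (s a d : ℕ → ℕ) : Submodule ℂ X where
  carrier := {y | ∃ z : ℕ → X, Tendsto z atTop (𝓝 0) ∧ ∀ ε : ℝ, 0 < ε → ∀ᶠ k in atTop,
    ∀ m ∈ Set.Icc (a k) (a k + d k), ‖(S ^ (s k + m)) (z k) - (S ^ m) y‖ < ε}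
  zero_mem' := ⟨fun _ => 0, tendsto_const_nhds, fun ε hε => by simp [hε]⟩
  add_mem' := by
    rintro x y ⟨z, hz, hx⟩ ⟨z', hz', hy⟩
    refine ⟨fun k => z k + z' k, by simpa using hz.add hz', fun ε hε => ?_⟩
    filter_upwards [hx (ε / 2) (half_pos hε), hy (ε / 2) (half_pos hε)] with k h1 h2 m hm
    rw [map_add, map_add, add_sub_add_comm]
    linarith [norm_add_le ((S ^ (s k + m)) (z k) - (S ^ m) x)
      ((S ^ (s k + m)) (z' k) - (S ^ m) y), h1 m hm, h2 m hm]
  smul_mem' := by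
    rintro c x ⟨z, hz, hx⟩
    refine ⟨fun k => c • z k, by simpa using hz.const_smul c, fun ε hε => ?_⟩
    filter_upwards [hx (ε / (‖c‖ + 1)) (by positivity)] with k h1 m hm
    rw [map_smul, map_smul, ← smul_sub, norm_smul]
    have h2 := h1 m hm
    rw [lt_div_iff₀ (by positivity)] at h2
    nlinarith [norm_nonneg ((S ^ (s k + m)) (z k) - (S ^ m) x), norm_nonneg c]

/-- `shadowedVectors` is invariant under every operator commuting with `S`. -/
theorem map_mem_shadowedVectors {S R : X →L[ℂ] X} (hSR : Commute S R) {s a d : ℕ → ℕ} {y : X}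
    (hy : y ∈ shadowedVectors S s a d) : R y ∈ shadowedVectors S s a d := by
  obtain ⟨z, hz, h⟩ := hy
  have hcomm : ∀ m x, (S ^ m) (R x) = R ((S ^ m) x) := fun m x => by
    rw [← mul_apply_eq_comp, (hSR.pow_left m).eq, mul_apply_eq_comp]
  refine ⟨fun k => R (z k), by simpa [Function.comp_def] using (R.continuous.tendsto 0).comp hz, fun ε hε => ?_⟩
  filter_upwards [h (ε / (‖R‖ + 1)) (by positivity)] with k h1 m hm
  rw [hcomm, hcomm, ← map_sub]
  have h2 := h1 m hm
  rw [lt_div_iff₀ (by positivity)] at h2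
  have h3 := R.le_opNorm ((S ^ (s k + m)) (z k) - (S ^ m) y)
  have h4 := norm_nonneg ((S ^ (s k + m)) (z k) - (S ^ m) y)
  nlinarith [norm_nonneg R]

/-- An operator with a dense set of periodic vectors shadowed on windows that make up, infinitely
often, a positive proportion of the elapsed time is `𝒰`-frequently hypercyclic. -/
theorem isUFrequentlyHypercyclic_of_shadowedVectors [CompleteSpace X] [SecondCountableTopology X]
    (S : X →L[ℂ] X) (s a d : ℕ → ℕ) (C : ℕ) (hd : Tendsto d atTop atTop)
    (hC : ∃ᶠ k in atTop, s k + a k + d k ≤ C * d k)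
    (hdense : Dense ((periodicVectors S ⊓ shadowedVectors S s a d : Submodule ℂ X) : Set X)) :
    IsUFrequentlyHypercyclic S := by
  refine isUFrequentlyHypercyclic_of_frequent_visits S fun V hVo hVn => ?_
  obtain ⟨y, hyV, ⟨P, hP, hyP⟩, hyS⟩ := hdense.inter_open_nonempty V hVo hVn
  obtain ⟨ε, hε, hεV⟩ := Metric.isOpen_iff.1 hVo y hyV
  -- The constant involves only the period of `y` and `C`; it must be fixed before `U`, hence before
  -- the period `Q`.
  refine ⟨1 / (2 * P * (C + 1)), by positivity, fun U hUo hUn n => ?_⟩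
  obtain ⟨u, huU, ⟨Q, hQ, huQ⟩, huS⟩ := hdense.inter_open_nonempty U hUo hUn
  obtain ⟨r, hr, hrU⟩ := Metric.isOpen_iff.1 hUo u huU
  have hmem : ∀ t, y - (S ^ t) u ∈ shadowedVectors S s a d := fun t =>
    sub_mem hyS (map_mem_shadowedVectors ((Commute.refl S).pow_right t) huS)
  choose z hz hzS using hmem
  -- The residue of `s k` is unknown until `k` is chosen, so all `Q` residues are controlled at
  -- once.
  have hsmall : ∀ᶠ k in atTop, ∀ t ∈ Set.Iio Q, ‖z t k‖ < r := by
    rw [(Set.finite_Iio Q).eventually_all]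
    intro t _
    simpa using (hz t).eventually (Metric.ball_mem_nhds 0 hr)
  have hclose : ∀ᶠ k in atTop, ∀ t ∈ Set.Iio Q, ∀ m ∈ Set.Icc (a k) (a k + d k),
      ‖(S ^ (s k + m)) (z t k) - (S ^ m) (y - (S ^ t) u)‖ < ε := by
    rw [(Set.finite_Iio Q).eventually_all]
    exact fun t _ => hzS t ε hε
  obtain ⟨k, hCk, hk1, hk2, hdk⟩ := (hC.and_eventually (hsmall.and (hclose.and
    (hd.eventually_ge_atTop (max (max n P) 1))))).exists
  have hdn : n ≤ d k := (le_max_left n P).trans ((le_max_left _ _).trans hdk)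
  have hdP : P ≤ d k := (le_max_right n P).trans ((le_max_left _ _).trans hdk)
  have hd1 : 1 ≤ d k := (le_max_right _ _).trans hdk
  set t := s k % Q with ht
  have htQ : t ∈ Set.Iio Q := Nat.mod_lt _ hQ
  refine ⟨u + z t k, hrU (by simpa using hk1 t htQ), s k + a k + d k, by omega, ?_⟩
  set A := {m : ℕ | (S ^ m) (u + z t k) ∈ V} ∩ Set.Iic (s k + a k + d k) with hA
  -- `P * (a k / P + 1)` is the first multiple of `P` beyond `a k`; at multiples of `P` the orbit of
  -- `y` is back at `y`.
  have hvisit : ∀ j < d k / P, s k + P * (a k / P + 1 + j) ∈ A := by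
    intro j hj
    have h1 : P * (j + 1) ≤ d k := (Nat.mul_le_mul_left P hj).trans (Nat.mul_div_le _ _)
    have h2 := Nat.mul_div_le (a k) P
    have h3 : a k < P * (a k / P + 1) := by
      exact Nat.lt_mul_div_succ _ hP
    have h4 : P * (a k / P + 1 + j) = P * (a k / P) + P * (j + 1) := by ring
    have h5 : P * (a k / P + 1 + j) = P * (a k / P + 1) + P * j := by ring
    refine ⟨hεV ?_, Set.mem_Iic.2 (by omega)⟩
    have h6 := hk2 t htQ (P * (a k / P + 1 + j)) ⟨by omega, by omega⟩
    rw [Metric.mem_ball, dist_eq_norm]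
    refine lt_of_eq_of_lt (congrArg norm ?_) h6
    rw [map_sub, pow_mul_apply_of_periodic hyP, map_add, ht, pow_mod_apply_of_periodic huQ,
      ← mul_apply_eq_comp, ← pow_add, add_comm (P * _) (s k)]
    abel
  have hcard : d k / P ≤ A.ncard := by
    have hAfin : A.Finite := (Set.finite_Iic _).inter_of_right _
    have hinj : Function.Injective fun j => s k + P * (a k / P + 1 + j) := by
      intro i j hij
      have := Nat.eq_of_mul_eq_mul_left hP (Nat.add_left_cancel hij)
      omega
    have hsub : (fun j => s k + P * (a k / P + 1 + j)) '' Set.Iio (d k / P) ⊆ A := by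
      rintro _ ⟨j, hj, rfl⟩
      exact hvisit j hj
    have := Set.ncard_le_ncard hsub hAfin
    rwa [Set.ncard_image_of_injective _ hinj, ← Finset.coe_Iio, Set.ncard_coe_finset,
      Nat.card_Iio] at this
  -- Rounding down loses at most a factor `2`, because `P ≤ d k`.
  have hq : d k ≤ 2 * P * (d k / P) := by
    have h1 : d k < P * (d k / P + 1) := Nat.lt_mul_div_succ _ hP
    rw [mul_add, mul_one] at h1
    have h2 : P * 1 ≤ P * (d k / P) := Nat.mul_le_mul_left P (Nat.div_pos hdP hP)
    have h3 : 2 * P * (d k / P) = P * (d k / P) + P * (d k / P) := by ring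
    omega
  have hN : s k + a k + d k + 1 ≤ 2 * P * (C + 1) * A.ncard :=
    calc s k + a k + d k + 1 ≤ (C + 1) * d k := by rw [add_mul, one_mul]; omega
      _ ≤ (C + 1) * (2 * P * (d k / P)) := Nat.mul_le_mul_left _ hq
      _ ≤ (C + 1) * (2 * P * A.ncard) :=
        Nat.mul_le_mul_left _ (Nat.mul_le_mul_left _ hcard)
      _ = 2 * P * (C + 1) * A.ncard := by ring
  rw [div_mul_eq_mul_div, one_mul, div_le_iff₀ (by positivity)]
  rw [mul_comm]
  exact_mod_cast hN

end Criterion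

/-! ### Density and separability in `ℓ^p` -/

theorem dense_of_basisVec_mem {p : ℝ≥0∞} [Fact (1 ≤ p)] (hp : p ≠ ∞) {Y : Submodule ℂ (EllP p)}
    (h : ∀ k, basisVec p k ∈ Y) : Dense (Y : Set (EllP p)) := by
  intro x
  refine mem_closure_of_tendsto (lp.hasSum_single hp x) (Eventually.of_forall fun s => ?_)
  refine Y.sum_mem fun i _ => ?_
  have : (lp.single p i (x i) : EllP p) = x i • basisVec p i := by
    rw [← lp.single_smul, smul_eq_mul, mul_one]
  rw [this]
  exact Y.smul_mem _ (h i)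

theorem secondCountableTopology_ellP {p : ℝ≥0∞} [Fact (1 ≤ p)] (hp : p ≠ ∞) :
    SecondCountableTopology (EllP p) := by
  have h1 : TopologicalSpace.IsSeparable
      (Submodule.span ℂ (Set.range (basisVec p)) : Set (EllP p)) :=
    (Set.countable_range _).isSeparable.span
  have h2 : Dense (Submodule.span ℂ (Set.range (basisVec p)) : Set (EllP p)) :=
    dense_of_basisVec_mem hp fun k => Submodule.subset_span ⟨k, rfl⟩
  have h3 : TopologicalSpace.SeparableSpace (EllP p) := by
    rw [← TopologicalSpace.isSeparable_univ_iff, ← h2.closure_eq]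
    exact h1.closure
  exact UniformSpace.secondCountable_of_separable _

/-! ### Operators of C-type: iterates, periodic vectors and the inverse -/

namespace CTypeData

variable (D : CTypeData)

theorem b_lt_b_succ (n : ℕ) : D.b n < D.b (n + 1) := D.b_strictMono (Nat.lt_succ_self n)

theorem W_ne_zero (n : ℕ) : D.W n ≠ 0 := by
  obtain ⟨c, hc, h⟩ := D.W_bddBelow
  exact norm_pos_iff.1 (hc.trans_le (h n))

theorem w_ne_zero {k : ℕ} (hk : 1 ≤ k) : D.w k ≠ 0 := by
  obtain ⟨c, hc, h⟩ := D.w_bddBelow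
  exact norm_pos_iff.1 (hc.trans_le (h k hk))

theorem W_eq_prod_range (n : ℕ) :
    D.W n = ∏ l ∈ Finset.range (D.b (n + 1) - D.b n - 1), D.w (D.b n + (l + 1)) := by
  rw [W, ← Finset.Ico_add_one_left_eq_Ioo, Finset.prod_Ico_eq_prod_range, Nat.sub_sub]
  exact Finset.prod_congr rfl fun l _ => by rw [add_assoc, add_comm 1 l]

/-- The image of `e_{b_n}` under the inverse of the operator of C-type. -/
noncomputable def inverseColumn (p : ℝ≥0∞) : ℕ → EllP p
  | 0 => -(D.W 0 • basisVec p (D.b 1 - 1))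
  | n + 1 => (D.W (n + 1) * D.v (n + 1)) • inverseColumn p (D.φ (n + 1)) -
      D.W (n + 1) • basisVec p (D.b (n + 2) - 1)
  termination_by n => n
  decreasing_by exact D.φ_lt _ (Nat.succ_pos _)

variable {D} in
theorem inverseColumn_of_pos {p : ℝ≥0∞} {n : ℕ} (hn : 1 ≤ n) : D.inverseColumn p n =
    (D.W n * D.v n) • D.inverseColumn p (D.φ n) - D.W n • basisVec p (D.b (n + 1) - 1) := by
  obtain ⟨m, rfl⟩ := Nat.exists_eq_add_of_le' hn
  rw [inverseColumn]

variable {D} {p : ℝ≥0∞} [Fact (1 ≤ p)] {T : EllP p →L[ℂ] EllP p}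

theorem ActsOnBasis.pow_apply (hT : D.ActsOnBasis T) {n i : ℕ} (h : D.b n + i < D.b (n + 1)) :
    (T ^ i) (basisVec p (D.b n)) =
      (∏ l ∈ Finset.range i, D.w (D.b n + (l + 1))) • basisVec p (D.b n + i) := by
  induction i with
  | zero => simp
  | succ i ih =>
    rw [pow_succ', mul_apply_eq_comp, ih (by omega), map_smul, hT.shift n _ (by omega) (by omega),
      smul_smul, Finset.prod_range_succ, add_assoc]

theorem ActsOnBasis.pow_pred_block_apply (hT : D.ActsOnBasis T) (n : ℕ) :
    (T ^ (D.b (n + 1) - D.b n - 1)) (basisVec p (D.b n)) =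
      D.W n • basisVec p (D.b (n + 1) - 1) := by
  have := D.b_lt_b_succ n
  rw [hT.pow_apply (by omega), ← D.W_eq_prod_range]
  congr 2
  omega

/-- Crossing the block multiplies by `W_n`, which cancels the factor `W_n⁻¹` of the last step. -/
theorem ActsOnBasis.pow_block_apply (hT : D.ActsOnBasis T) {n : ℕ} (hn : 1 ≤ n) :
    (T ^ (D.b (n + 1) - D.b n)) (basisVec p (D.b n)) =
      (D.W n * D.v n) • basisVec p (D.b (D.φ n)) - basisVec p (D.b n) := by
  have := D.b_lt_b_succ n
  rw [show D.b (n + 1) - D.b n = (D.b (n + 1) - D.b n - 1) + 1 by omega, pow_succ',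
    mul_apply_eq_comp, hT.pow_pred_block_apply, map_smul, hT.last n hn, smul_sub, smul_smul,
    smul_smul, mul_inv_cancel₀ (D.W_ne_zero n), one_smul]

theorem ActsOnBasis.pow_block_zero_apply (hT : D.ActsOnBasis T) :
    (T ^ (D.b 1 - D.b 0)) (basisVec p (D.b 0)) = -basisVec p (D.b 0) := by
  have := D.b_lt_b_succ 0
  have h := hT.pow_pred_block_apply 0
  rw [zero_add] at h this
  rw [show D.b 1 - D.b 0 = (D.b 1 - D.b 0 - 1) + 1 by omega, pow_succ',
    mul_apply_eq_comp, h, map_smul, hT.first, smul_neg, smul_smul,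
    mul_inv_cancel₀ (D.W_ne_zero 0), one_smul, D.b_zero]

/-- By induction and `b_dvd`, one crossing of block `n` fixes `e_{b_{φ n}}`. A second crossing
therefore adds the same multiple of it with the opposite sign. -/
theorem ActsOnBasis.pow_two_mul_block_apply (hT : D.ActsOnBasis T) (n : ℕ) :
    (T ^ (2 * (D.b (n + 1) - D.b n))) (basisVec p (D.b n)) = basisVec p (D.b n) := by
  induction n using Nat.strong_induction_on with
  | _ n ih =>
    rw [two_mul, pow_add, mul_apply_eq_comp]
    rcases Nat.eq_zero_or_pos n with rfl | hn
    · rw [zero_add, hT.pow_block_zero_apply, map_neg, hT.pow_block_zero_apply, neg_neg]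
    · obtain ⟨q, hq⟩ := D.b_dvd n hn
      have hφ : (T ^ (D.b (n + 1) - D.b n)) (basisVec p (D.b (D.φ n))) =
          basisVec p (D.b (D.φ n)) := by
        rw [hq]
        exact pow_mul_apply_of_periodic (ih _ (D.φ_lt n hn)) q
      rw [hT.pow_block_apply hn, map_sub, map_smul, hφ, hT.pow_block_apply hn]
      abel

/-- Properties stable under scaling and under `T` thus need checking only at the first vector of
each block. -/
theorem ActsOnBasis.exists_basisVec_eq (hT : D.ActsOnBasis T) (k : ℕ) :
    ∃ n i, ∃ c : ℂ, basisVec p k = c • (T ^ i) (basisVec p (D.b n)) := by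
  obtain ⟨n, h1, h2⟩ := D.exists_block k
  obtain ⟨i, rfl⟩ := Nat.exists_eq_add_of_le h1
  refine ⟨n, i, (∏ l ∈ Finset.range i, D.w (D.b n + (l + 1)))⁻¹, ?_⟩
  rw [hT.pow_apply h2, smul_smul, inv_mul_cancel₀, one_smul]
  exact Finset.prod_ne_zero_iff.2 fun l _ => D.w_ne_zero (by omega)

/-- The recursion for `inverseColumn` is the relation `last` solved for `e_{b_n}`. -/
theorem ActsOnBasis.apply_inverseColumn (hT : D.ActsOnBasis T) (n : ℕ) :
    T (D.inverseColumn p n) = basisVec p (D.b n) := by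
  induction n using Nat.strong_induction_on with
  | _ n ih =>
    rcases Nat.eq_zero_or_pos n with rfl | hn
    · rw [inverseColumn, map_neg, map_smul, hT.first, smul_neg, neg_neg, smul_smul,
        mul_inv_cancel₀ (D.W_ne_zero 0), one_smul, D.b_zero]
    · rw [inverseColumn_of_pos hn, map_sub, map_smul, map_smul, ih _ (D.φ_lt n hn), hT.last n hn,
        smul_sub, smul_smul, smul_smul, mul_inv_cancel₀ (D.W_ne_zero n), one_smul]
      abel

/-- A bound `M ≥ 2` propagates along `φ`, since `M / 2 + 1 ≤ M`. The block `0` carries no bound on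
`W`, whence the second term of the maximum. -/
theorem norm_inverseColumn_le (hW : ∀ n, 1 ≤ n → ‖D.W n‖ ≤ 1) (hv : ∀ n, 1 ≤ n → ‖D.v n‖ ≤ 1 / 2)
    (n : ℕ) : ‖D.inverseColumn p n‖ ≤ max 2 ‖D.W 0‖ := by
  have hp1 : 0 < p := zero_lt_one.trans_le (Fact.out : 1 ≤ p)
  induction n using Nat.strong_induction_on with
  | _ n ih =>
    rcases Nat.eq_zero_or_pos n with rfl | hn
    · rw [inverseColumn, norm_neg, norm_smul, lp.norm_single hp1, norm_one, mul_one]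
      exact le_max_right _ _
    · have h1 := ih _ (D.φ_lt n hn)
      have h2 : (2 : ℝ) ≤ max 2 ‖D.W 0‖ := le_max_left _ _
      rw [inverseColumn_of_pos hn]
      refine (norm_sub_le _ _).trans ?_
      rw [norm_smul, norm_smul, lp.norm_single hp1, norm_one, mul_one, norm_mul]
      have h3 : ‖D.W n‖ * ‖D.v n‖ ≤ 1 * (1 / 2) :=
        mul_le_mul (hW n hn) (hv n hn) (norm_nonneg _) zero_le_one
      have h4 := mul_le_mul h3 h1 (norm_nonneg _) (by norm_num)
      linarith [hW n hn]

/-- A bounded operator acting on the canonical basis as the inverse of an operator of C-type. -/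
theorem exists_inverse_on_basis (hp : p ≠ ∞) (hW : ∀ n, 1 ≤ n → ‖D.W n‖ ≤ 1)
    (hv : ∀ n, 1 ≤ n → ‖D.v n‖ ≤ 1 / 2) :
    ∃ S : EllP p →L[ℂ] EllP p, (∀ n, S (basisVec p (D.b n)) = D.inverseColumn p n) ∧
      ∀ n k, D.b n ≤ k → k + 1 < D.b (n + 1) →
        S (basisVec p (k + 1)) = (D.w (k + 1))⁻¹ • basisVec p k := by
  classical
  have hb1 := D.b_lt_b_succ
  have hbinj := D.b_strictMono.injective
  have hp1 : 0 < p := zero_lt_one.trans_le (Fact.out : 1 ≤ p)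
  -- `σ` sends the last position of a block to its first and any other `j` to `j + 1`; the terms
  -- with `v` are left to the summable series `F` of rank-one operators.
  let σ : ℕ → ℕ := fun j => if h : ∃ n, D.b (n + 1) = j + 1 then D.b h.choose else j + 1
  let a : ℕ → ℂ := fun j =>
    if h : ∃ n, D.b (n + 1) = j + 1 then -D.W h.choose else (D.w (j + 1))⁻¹
  have hlast : ∀ n, D.b (n + 1) = D.b (n + 1) - 1 + 1 := fun n => by have := hb1 n; omega
  have hchoose : ∀ n (h : ∃ m, D.b (m + 1) = D.b (n + 1) - 1 + 1), h.choose = n := fun n h =>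
    Nat.succ_injective (hbinj (h.choose_spec.trans (hlast n).symm))
  have hσb : ∀ n, σ (D.b (n + 1) - 1) = D.b n := by
    intro n
    have h : ∃ m, D.b (m + 1) = D.b (n + 1) - 1 + 1 := ⟨n, hlast n⟩
    simp only [σ, dif_pos h, hchoose n h]
  have hab : ∀ n, a (D.b (n + 1) - 1) = -D.W n := by
    intro n
    have h : ∃ m, D.b (m + 1) = D.b (n + 1) - 1 + 1 := ⟨n, hlast n⟩
    simp only [a, dif_pos h, hchoose n h]
  have hform : ∀ j, (∃ n, D.b (n + 1) = j + 1) → ∃ n, j = D.b (n + 1) - 1 := by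
    rintro j ⟨n, h⟩
    exact ⟨n, by omega⟩
  have hnb : ∀ j, (¬ ∃ n, D.b (n + 1) = j + 1) → ∀ n, D.b n ≠ j + 1 := by
    rintro j hj (_ | n) h
    · rw [D.b_zero] at h; omega
    · exact hj ⟨n, h⟩
  have hσ : Function.Injective σ := by
    intro i j hij
    by_cases hi : ∃ n, D.b (n + 1) = i + 1 <;> by_cases hj : ∃ n, D.b (n + 1) = j + 1
    · obtain ⟨n, rfl⟩ := hform i hi
      obtain ⟨m, rfl⟩ := hform j hj
      rw [hσb, hσb] at hij
      rw [hbinj hij]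
    · obtain ⟨n, rfl⟩ := hform i hi
      rw [hσb] at hij
      simp only [σ, dif_neg hj] at hij
      exact absurd hij (hnb j hj n)
    · obtain ⟨n, rfl⟩ := hform j hj
      rw [hσb] at hij
      simp only [σ, dif_neg hi] at hij
      exact absurd hij.symm (hnb i hi n)
    · simp only [σ, dif_neg hi, dif_neg hj] at hij
      omega
  obtain ⟨c, hc, hw⟩ := D.w_bddBelow
  have ha : ∀ j, ‖a j‖ ≤ max (max 1 ‖D.W 0‖) c⁻¹ := by
    intro j
    by_cases hj : ∃ n, D.b (n + 1) = j + 1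
    · obtain ⟨n, rfl⟩ := hform j hj
      rw [hab, norm_neg]
      refine le_trans ?_ (le_max_left _ _)
      rcases Nat.eq_zero_or_pos n with rfl | hn
      · exact le_max_right _ _
      · exact (hW n hn).trans (le_max_left _ _)
    · simp only [a, dif_neg hj, norm_inv]
      exact (inv_anti₀ hc (hw (j + 1) (by omega))).trans (le_max_right _ _)
  obtain ⟨A, hA⟩ := exists_weighted_relabelling hp σ hσ a _ ha
  let F : ℕ → (EllP p →L[ℂ] EllP p) := fun n =>
    (D.W (n + 1) * D.v (n + 1)) • (lp.evalCLM ℂ (fun _ : ℕ => ℂ) p (D.b (n + 1))).smulRight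
      (D.inverseColumn p (D.φ (n + 1)))
  have hFapp : ∀ n x, F n x = (D.W (n + 1) * D.v (n + 1) * x (D.b (n + 1))) •
      D.inverseColumn p (D.φ (n + 1)) := by
    intro n x
    simp only [F, smul_apply, ContinuousLinearMap.smulRight_apply, smul_smul]
    rfl
  have hF : Summable F := by
    refine Summable.of_norm_bounded (D.summable_v.mul_right (max 2 ‖D.W 0‖)) fun n => ?_
    refine ContinuousLinearMap.opNorm_le_bound _ (by positivity) fun x => ?_
    rw [hFapp, norm_smul, norm_mul, norm_mul]
    have h1 := hW (n + 1) (by omega)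
    have h2 := norm_inverseColumn_le (p := p) hW hv (D.φ (n + 1))
    have h3 : ‖x (D.b (n + 1))‖ ≤ ‖x‖ := lp.norm_apply_le_norm hp1.ne' x _
    calc ‖D.W (n + 1)‖ * ‖D.v (n + 1)‖ * ‖x (D.b (n + 1))‖ * ‖D.inverseColumn p (D.φ (n + 1))‖
        ≤ 1 * ‖D.v (n + 1)‖ * ‖x‖ * max 2 ‖D.W 0‖ := by gcongr
      _ = ‖D.v (n + 1)‖ * max 2 ‖D.W 0‖ * ‖x‖ := by ring
  have hsum : ∀ x, (∑' n, F n) x = ∑' n, F n x := fun x =>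
    (ContinuousLinearMap.apply ℂ (EllP p) x).map_tsum hF
  have hK0 : ∀ k, (∀ n, D.b (n + 1) ≠ k) → (∑' n, F n) (basisVec p k) = 0 := by
    intro k hk
    rw [hsum]
    convert tsum_zero with n
    rw [hFapp, lp.single_apply_ne p _ _ (hk n)]
    simp
  have hK1 : ∀ n, (∑' n, F n) (basisVec p (D.b (n + 1))) =
      (D.W (n + 1) * D.v (n + 1)) • D.inverseColumn p (D.φ (n + 1)) := by
    intro n
    rw [hsum, tsum_eq_single n, hFapp, lp.single_apply_self, mul_one]
    intro m hm
    rw [hFapp, lp.single_apply_ne, mul_zero, zero_smul]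
    exact fun e => hm (Nat.succ_injective (hbinj e))
  refine ⟨A + ∑' n, F n, fun n => ?_, fun n k h1 h2 => ?_⟩
  · have e := hA (D.b (n + 1) - 1)
    rw [hσb, hab] at e
    rw [add_apply, e]
    rcases n with _ | n
    · rw [hK0, add_zero, inverseColumn, neg_smul]
      intro n h
      exact absurd (hbinj h) (Nat.succ_ne_zero n)
    · rw [hK1, inverseColumn_of_pos (Nat.succ_pos n), neg_smul]
      abel
  · have hk : ¬ ∃ m, D.b (m + 1) = k + 1 := by
      rintro ⟨m, hm⟩
      have h3 : n < m + 1 := D.b_strictMono.lt_iff_lt.1 (by omega)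
      have h4 : m + 1 < n + 1 := D.b_strictMono.lt_iff_lt.1 (by omega)
      omega
    have e := hA k
    simp only [σ, a, dif_neg hk] at e
    rw [add_apply, e, hK0, add_zero]
    exact fun m hm => hk ⟨m, hm⟩

theorem ActsOnBasis.exists_continuousLinearEquiv (hT : D.ActsOnBasis T) (hp : p ≠ ∞)
    (hW : ∀ n, 1 ≤ n → ‖D.W n‖ ≤ 1) (hv : ∀ n, 1 ≤ n → ‖D.v n‖ ≤ 1 / 2) :
    ∃ E : EllP p ≃L[ℂ] EllP p, (E : EllP p →L[ℂ] EllP p) = T := by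
  obtain ⟨S, hSb, hSs⟩ := exists_inverse_on_basis (p := p) hp hW hv
  have hext : ∀ R : EllP p →L[ℂ] EllP p, (∀ k, R (basisVec p k) = basisVec p k) →
      R = ContinuousLinearMap.id ℂ (EllP p) := fun R hR =>
    lp.ext_continuousLinearMap hp fun i => ContinuousLinearMap.ext_ring (hR i)
  have hST : S ∘SL T = ContinuousLinearMap.id ℂ (EllP p) := by
    refine hext _ fun k => ?_
    rw [ContinuousLinearMap.comp_apply]
    obtain ⟨n, h1, h2⟩ := D.exists_block k
    by_cases h : k + 1 < D.b (n + 1)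
    · rw [hT.shift n k h1 h, map_smul, hSs n k h1 h, smul_smul,
        mul_inv_cancel₀ (D.w_ne_zero (by omega)), one_smul]
    · obtain rfl : k = D.b (n + 1) - 1 := by omega
      rcases Nat.eq_zero_or_pos n with rfl | hn
      · have h0 := hSb 0
        rw [D.b_zero] at h0
        rw [zero_add, hT.first, map_neg, map_smul, h0, inverseColumn, smul_neg, neg_neg,
          smul_smul, inv_mul_cancel₀ (D.W_ne_zero 0), one_smul]
      · rw [hT.last n hn, map_sub, map_smul, map_smul, hSb, hSb, inverseColumn_of_pos hn,
          smul_sub, smul_smul, smul_smul, inv_mul_cancel₀ (D.W_ne_zero n), one_smul, ← mul_assoc,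
          inv_mul_cancel₀ (D.W_ne_zero n), one_mul]
        abel
  have hTS : T ∘SL S = ContinuousLinearMap.id ℂ (EllP p) := by
    refine hext _ fun k => ?_
    rw [ContinuousLinearMap.comp_apply]
    obtain ⟨n, h1, h2⟩ := D.exists_block k
    rcases h1.eq_or_lt with rfl | h1
    · rw [hSb, hT.apply_inverseColumn]
    · obtain ⟨i, rfl⟩ := Nat.exists_eq_add_of_lt h1
      rw [hSs n _ (by omega) h2, map_smul, hT.shift n _ (by omega) h2, smul_smul,
        inv_mul_cancel₀ (D.w_ne_zero (by omega)), one_smul]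
  exact ⟨ContinuousLinearEquiv.equivOfInverse T S (fun x => DFunLike.congr_fun hST x)
    (fun x => DFunLike.congr_fun hTS x), rfl⟩

end CTypeData

/-! ### Operators of C⁺-type with the weights `blockWeight` -/

/-- The exponent `e` such that `2^(-e)` is the product of the first `i` weights of a block. -/
def blockExponent (δ η Δ i : ℕ) : ℕ :=
  if i ≤ δ then i
  else if i ≤ 2 * δ then 2 * δ - i
  else if i + 2 * δ + 2 * η < Δ then 0
  else if i + δ + 2 * η < Δ then i + 1 + 2 * δ + 2 * η - Δ
  else if i + δ + η < Δ then δ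
  else if i + η < Δ then Δ - η - 1 - i
  else 0

/-- The product descends to `2^(-δ)`, returns to `1`, descends again, stays at `2^(-δ)`, and returns
to `1`. -/
theorem prod_blockWeight {δ η Δ i : ℕ} (h : 4 * δ + 2 * η < Δ) :
    ∏ l ∈ Finset.range i, blockWeight δ η Δ (l + 1) = (1 / 2 : ℂ) ^ blockExponent δ η Δ i := by
  induction i with
  | zero => simp [blockExponent]
  | succ i ih =>
    rw [Finset.prod_range_succ, ih]
    have up : ∀ {e e' : ℕ}, e' = e + 1 → (1 / 2 : ℂ) ^ e * (1 / 2) = (1 / 2) ^ e' := by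
      rintro e _ rfl; rw [pow_succ]
    have down : ∀ {e e' : ℕ}, e = e' + 1 → (1 / 2 : ℂ) ^ e * 2 = (1 / 2) ^ e' := by
      rintro _ e' rfl; rw [pow_succ]; ring
    have same : ∀ {e e' : ℕ}, e = e' → (1 / 2 : ℂ) ^ e * 1 = (1 / 2) ^ e' := by
      rintro e _ rfl; rw [mul_one]
    unfold blockWeight
    split_ifs
    · exact up (by unfold blockExponent; grind)
    · exact down (by unfold blockExponent; grind)
    · exact same (by unfold blockExponent; grind)
    · exact up (by unfold blockExponent; grind)
    · exact same (by unfold blockExponent; grind)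
    · exact down (by unfold blockExponent; grind)
    · exact same (by unfold blockExponent; grind)

/-- This is the second plateau: `Δ - δ - 2η - 1` is the position of the last weight `1/2`, and the
`η` weights after it equal `1`. -/
theorem blockExponent_sub {δ η Δ m : ℕ} (h : 4 * δ + 2 * η < Δ) (h1 : δ + η + 1 ≤ m)
    (h2 : m ≤ δ + η + 1 + η) : blockExponent δ η Δ (Δ - m) = δ := by
  unfold blockExponent
  split_ifs <;> omega

theorem exists_generation {n : ℕ} (hn : 1 ≤ n) :
    ∃ k, 1 ≤ k ∧ n ∈ Set.Ico (2 ^ (k - 1)) (2 ^ k) :=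
  ⟨Nat.log 2 n + 1, by omega, Nat.pow_log_le_self 2 (by omega),
    Nat.lt_pow_succ_log_self one_lt_two n⟩

theorem tendsto_two_pow_mul_half_pow {τ δ : ℕ → ℕ}
    (h : Tendsto (fun k => (δ k : ℤ) - (τ k : ℤ)) atTop atTop) :
    Tendsto (fun k => (2 : ℝ) ^ τ k * (1 / 2) ^ δ k) atTop (𝓝 0) := by
  rw [Metric.tendsto_atTop']
  intro ε hε
  obtain ⟨M, hM⟩ := exists_pow_lt_of_lt_one hε (show (1 / 2 : ℝ) < 1 by norm_num)
  obtain ⟨N, hN⟩ := eventually_atTop.1 (h.eventually_ge_atTop (M : ℤ))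
  refine ⟨N, fun k hk => ?_⟩
  -- With `δ k = τ k + M + r`, the power `2^(τ k)` cancels and a factor `(1/2)^M` is left.
  obtain ⟨r, hr⟩ := Nat.exists_eq_add_of_le (show τ k + M ≤ δ k by have := hN k hk.le; omega)
  rw [Real.dist_0_eq_abs, abs_of_nonneg (by positivity), hr, pow_add, pow_add, ← mul_assoc,
    ← mul_assoc, ← mul_pow]
  norm_num only [one_pow, one_mul]
  refine lt_of_le_of_lt ?_ hM
  exact mul_le_of_le_one_right (by positivity) (pow_le_one₀ (by norm_num) (by norm_num))

theorem exists_frequently_le_mul {δ η : ℕ → ℕ} (hη : ∀ k, 1 ≤ k → 0 < η k)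
    (h : liminf (fun k => (δ k : ℝ≥0∞) / (η k : ℝ≥0∞)) atTop < ∞) :
    ∃ C : ℕ, ∃ᶠ k in atTop, δ k ≤ C * η k := by
  obtain ⟨C, hC⟩ := ENNReal.exists_nat_gt h.ne
  refine ⟨C, ((frequently_lt_of_liminf_lt (by isBoundedDefault) hC).and_eventually
    (eventually_ge_atTop 1)).mono fun k hk => ?_⟩
  have h1 := hη k hk.2
  have h2 := (ENNReal.div_le_iff (by exact_mod_cast h1.ne') (ENNReal.natCast_ne_top _)).1 hk.1.le
  exact_mod_cast h2

namespace CTypeData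

variable {D : CTypeData} {Δ τ δ η : ℕ → ℕ}

theorem IsCPlusType.prod_w (hD : D.IsCPlusType Δ (fun k => ((2 : ℂ) ^ τ k)⁻¹)
      (fun k i => blockWeight (δ k) (η k) (Δ k) i)) {k n i : ℕ} (hk : 1 ≤ k)
    (hΔ : 4 * δ k + 2 * η k < Δ k) (hn : n ∈ Set.Ico (2 ^ (k - 1)) (2 ^ k)) (hi : i < Δ k) :
    ∏ l ∈ Finset.range i, D.w (D.b n + (l + 1)) =
      (1 / 2 : ℂ) ^ blockExponent (δ k) (η k) (Δ k) i := by
  rw [← prod_blockWeight hΔ]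
  refine Finset.prod_congr rfl fun l hl => hD.w_eq k hk n hn _ (by omega) ?_
  have := Finset.mem_range.1 hl
  omega

/-- Each block contains as many weights `1/2` as weights `2`. -/
theorem IsCPlusType.W_eq_one (hD : D.IsCPlusType Δ (fun k => ((2 : ℂ) ^ τ k)⁻¹)
      (fun k i => blockWeight (δ k) (η k) (Δ k) i)) {k n : ℕ} (hk : 1 ≤ k)
    (hΔ : 4 * δ k + 2 * η k < Δ k) (hn : n ∈ Set.Ico (2 ^ (k - 1)) (2 ^ k)) : D.W n = 1 := by
  rw [W_eq_prod_range, hD.block_size k hk n hn, hD.prod_w hk hΔ hn (by omega)]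
  have : blockExponent (δ k) (η k) (Δ k) (Δ k - 1) = 0 := by unfold blockExponent; grind
  rw [this, pow_zero]

variable {p : ℝ≥0∞} [Fact (1 ≤ p)]

theorem IsCPlusType.norm_pow_apply (hD : D.IsCPlusType Δ (fun k => ((2 : ℂ) ^ τ k)⁻¹)
      (fun k i => blockWeight (δ k) (η k) (Δ k) i)) {T : EllP p →L[ℂ] EllP p}
    (hT : D.ActsOnBasis T) {k n i : ℕ} (hk : 1 ≤ k)
    (hΔ : 4 * δ k + 2 * η k < Δ k) (hn : n ∈ Set.Ico (2 ^ (k - 1)) (2 ^ k)) (hi : i < Δ k) :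
    ‖(T ^ i) (basisVec p (D.b n))‖ = (1 / 2) ^ blockExponent (δ k) (η k) (Δ k) i := by
  have hp1 : 0 < p := zero_lt_one.trans_le (Fact.out : 1 ≤ p)
  have h1 := hD.block_size k hk n hn
  rw [hT.pow_apply (by omega), hD.prod_w hk hΔ hn hi, norm_smul, lp.norm_single hp1, norm_one,
    mul_one, norm_pow]
  norm_num

theorem IsCPlusType.basisVec_mem_shadowedVectors
    (hD : D.IsCPlusType Δ (fun k => ((2 : ℂ) ^ τ k)⁻¹)
      (fun k i => blockWeight (δ k) (η k) (Δ k) i))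
    (hΔ : ∀ k, 1 ≤ k → 4 * δ k + 2 * η k < Δ k)
    (hδτ : Tendsto (fun k => (δ k : ℤ) - (τ k : ℤ)) atTop atTop)
    {T S : EllP p →L[ℂ] EllP p} (hT : D.ActsOnBasis T) (hST : ∀ i x, (S ^ i) ((T ^ i) x) = x)
    (j : ℕ) :
    basisVec p (D.b j) ∈ shadowedVectors S δ (fun k => δ k + η k + 1) η := by
  -- Once `j < 2^(k-1)`, generation `k` contains an index that `φ` sends to `j`.
  have hn : ∀ k, j + 1 ≤ k → j + 2 ^ (k - 1) ∈ Set.Ico (2 ^ (k - 1)) (2 ^ k) := by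
    intro k hk
    have h1 : j < 2 ^ (k - 1) :=
      Nat.lt_two_pow_self.trans_le (Nat.pow_le_pow_right two_pos (by omega))
    have h2 : 2 ^ k = 2 * 2 ^ (k - 1) := by rw [← pow_succ']; congr 1; omega
    exact ⟨by omega, by omega⟩
  have hlim := tendsto_two_pow_mul_half_pow hδτ
  -- Applying `T^δ` brings `e_{b_n}` down to norm `2^(-δ)`, which beats the factor `2^τ`; the delay
  -- `δ` undoes it.
  refine ⟨fun k => (2 : ℂ) ^ τ k • (T ^ δ k) (basisVec p (D.b (j + 2 ^ (k - 1)))), ?_, ?_⟩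
  · rw [tendsto_zero_iff_norm_tendsto_zero]
    refine hlim.congr' ?_
    filter_upwards [eventually_ge_atTop (j + 1)] with k hk
    have hΔk := hΔ k (by omega)
    rw [norm_smul, hD.norm_pow_apply hT (by omega) hΔk (hn k hk) (by omega), norm_pow]
    simp [blockExponent]
  · intro ε hε
    filter_upwards [eventually_ge_atTop (j + 1), hlim.eventually_lt_const hε] with k hk hkε m hm
    have hk1 : 1 ≤ k := by omega
    have hΔk := hΔ k hk1
    have hnk := hn k hk
    have hm1 := hm.1
    have hm2 := hm.2
    set n := j + 2 ^ (k - 1) with hndef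
    have hblock := hT.pow_block_apply (n := n) (Nat.one_le_two_pow.trans hnk.1)
    rw [hD.block_size k hk1 n hnk, hD.W_eq_one hk1 hΔk hnk, one_mul, hD.v_eq k hk1 n hnk,
      hD.φ_eq k hk1 n hnk, hndef, Nat.add_sub_cancel, ← hndef] at hblock
    have hsplit : basisVec p (D.b n) =
        ((2 : ℂ) ^ τ k)⁻¹ • basisVec p (D.b j) - (T ^ Δ k) (basisVec p (D.b n)) := by
      rw [hblock]; abel
    have hcancel : (S ^ m) ((T ^ Δ k) (basisVec p (D.b n))) =
        (T ^ (Δ k - m)) (basisVec p (D.b n)) := by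
      conv_lhs => rw [show Δ k = m + (Δ k - m) by omega, pow_add, mul_apply_eq_comp, hST]
    -- The factor `2^τ` normalises the component along `e_{b_j}`; only the part still inside block
    -- `n` remains as error.
    have hdiff : (S ^ (δ k + m)) ((2 : ℂ) ^ τ k • (T ^ δ k) (basisVec p (D.b n))) -
        (S ^ m) (basisVec p (D.b j)) =
        -((2 : ℂ) ^ τ k • (T ^ (Δ k - m)) (basisVec p (D.b n))) := by
      rw [add_comm (δ k) m, pow_add, mul_apply_eq_comp, map_smul, map_smul, hST]
      conv_lhs => rw [hsplit]
      rw [map_sub, map_smul, hcancel, smul_sub, smul_smul,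
        mul_inv_cancel₀ (pow_ne_zero _ two_ne_zero), one_smul]
      abel
    rw [hdiff, norm_neg, norm_smul, hD.norm_pow_apply hT hk1 hΔk hnk (by omega), norm_pow]
    rw [blockExponent_sub hΔk hm1 hm2]
    simpa using hkε

end CTypeData

/-! ### Invertibility and `𝒰`-frequent hypercyclicity of the inverse -/

theorem proposition3p2 (p : ℝ≥0∞) [Fact (1 ≤ p)] (hp : p ≠ ∞)
    (D : CTypeData) (Δ τ δ η : ℕ → ℕ)
    (hτ_pos : ∀ k, 1 ≤ k → 0 < τ k) (hτ : StrictMonoOn τ (Set.Ici 1))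
    (hδ_pos : ∀ k, 1 ≤ k → 0 < δ k) (hδ : StrictMonoOn δ (Set.Ici 1))
    (hη_pos : ∀ k, 1 ≤ k → 0 < η k) (hη : StrictMonoOn η (Set.Ici 1))
    (hΔ : ∀ k, 1 ≤ k → 4 * δ k + 2 * η k < Δ k)
    (hD : D.IsCPlusType Δ (fun k => ((2 : ℂ) ^ τ k)⁻¹)
      (fun k i => blockWeight (δ k) (η k) (Δ k) i))
    (hδτ : Tendsto (fun k => (δ k : ℤ) - (τ k : ℤ)) atTop atTop)
    (hδη : liminf (fun k => (δ k : ℝ≥0∞) / (η k : ℝ≥0∞)) atTop < ∞) :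
    ∃ T : EllP p ≃L[ℂ] EllP p, (T : EllP p →L[ℂ] EllP p) = D.operator p hp ∧
      IsUFrequentlyHypercyclic (T.symm : EllP p →L[ℂ] EllP p) := by
  have hT := D.operator_actsOnBasis p hp
  have hW : ∀ n, 1 ≤ n → ‖D.W n‖ ≤ 1 := by
    intro n hn
    obtain ⟨k, hk, hnk⟩ := exists_generation hn
    rw [hD.W_eq_one hk (hΔ k hk) hnk, norm_one]
  have hv : ∀ n, 1 ≤ n → ‖D.v n‖ ≤ 1 / 2 := by
    intro n hn
    obtain ⟨k, hk, hnk⟩ := exists_generation hn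
    rw [hD.v_eq k hk n hnk, norm_inv, norm_pow, Complex.norm_ofNat, one_div]
    exact inv_anti₀ two_pos (le_self_pow₀ one_le_two (hτ_pos k hk).ne')
  obtain ⟨E, hE⟩ := hT.exists_continuousLinearEquiv hp hW hv
  refine ⟨E, hE, ?_⟩
  set T := D.operator p hp
  set S : EllP p →L[ℂ] EllP p := (E.symm : EllP p →L[ℂ] EllP p) with hS
  have hST : S * T = 1 := by
    rw [← hE]; ext1 x; exact E.symm_apply_apply x
  have hTS : T * S = 1 := by
    rw [← hE]; ext1 x; exact E.apply_symm_apply x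
  have hcomm : Commute S T := hST.trans hTS.symm
  have hpow : ∀ i x, (S ^ i) ((T ^ i) x) = x := fun i x => by
    rw [← mul_apply_eq_comp, ← hcomm.mul_pow, hST, one_pow, one_apply_eq_self]
  have hη_top : Tendsto η atTop atTop := by
    refine tendsto_atTop_atTop.2 fun N => ⟨N + 1, fun k hk => ?_⟩
    have : ∀ m, m < η (m + 1) := by
      intro m
      induction m with
      | zero => exact hη_pos 1 le_rfl
      | succ m ih =>
        have := hη (Set.mem_Ici.2 (by omega : 1 ≤ m + 1)) (Set.mem_Ici.2 (by omega : 1 ≤ m + 1 + 1))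
          (Nat.lt_succ_self _)
        omega
    obtain ⟨m, rfl⟩ := Nat.exists_eq_add_of_le' (show 1 ≤ k by omega)
    have := this m
    omega
  obtain ⟨C, hC⟩ := exists_frequently_le_mul hη_pos hδη
  have := secondCountableTopology_ellP hp
  refine isUFrequentlyHypercyclic_of_shadowedVectors S δ (fun k => δ k + η k + 1) η (2 * C + 3)
    hη_top ?_ (dense_of_basisVec_mem hp fun k => ?_)
  -- The elapsed time is `2δ + 2η + 1`, at most `(2C + 3)η` when `δ ≤ Cη` and `η ≥ 1`.
  · refine (hC.and_eventually (eventually_ge_atTop 1)).mono fun k hk => ?_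
    have h1 := hη_pos k hk.2
    have h2 := hk.1
    have h3 : (2 * C + 3) * η k = 2 * (C * η k) + 3 * η k := by ring
    omega
  · obtain ⟨n, i, c, hk⟩ := hT.exists_basisVec_eq k
    rw [hk]
    refine Submodule.smul_mem _ c ⟨?_, ?_⟩
    · have := D.b_lt_b_succ n
      refine ⟨2 * (D.b (n + 1) - D.b n), by omega, ?_⟩
      -- A period of `T` is a period of `S`: replace `e_{b_n}` by `T^P e_{b_n}`, then cancel `S^P`
      -- with `T^P`.
      conv_lhs =>
        rw [← hT.pow_two_mul_block_apply n, ← mul_apply_eq_comp (T ^ i),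
          ← pow_add, add_comm i, pow_add, mul_apply_eq_comp, hpow]
    · exact map_mem_shadowedVectors (hcomm.pow_right i)
        (hD.basisVec_mem_shadowedVectors hΔ hδτ hT hpow n)
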